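/- Let $A$ be a $C^*$-algebra and let $\mathbb{N}^{\oplus k}$ be the direct sum of $k$ copies of the additive semigroup $\mathbb{N}=\{0,1,2,\dots\}$ ($k$ may be infinite), with the coordinatewise order $\le$ and least upper bounds $m\vee n$. A Hilbert $A$-bimodule is a right Hilbert $A$-module $Y$ with a $*$-homomorphism $\phi:A\to\mathcal{L}(Y)$ into the adjointable operators; $\mathcal{K}(Y)$ denotes the closed linear span of the rank-one operators $\theta_{\xi,\eta}\zeta=\xi\langle\eta,\zeta\rangle$. Let $X$ be a product system over $\mathbb{N}^{\oplus k}$ of Hilbert $A$-bimodules: a semigroup fibred over $\mathbb{N}^{\oplus k}$ whose fibres $X_n$ are Hilbert $A$-bimodules with left actions $\phi_n$, such that $X_0={}_AA_A$, multiplication by elements of $X_0=A$ from the left and from the right is the left and the right action, and for $m,n\ne0$ the multiplication induces an isomorphism $M_{m,n}:X_m\otimes_AX_n\to X_{m+n}$ of Hilbert $A$-bimodules. For $p\le q$ and $S\in\mathcal{K}(X_p)$ let $\iota_p^q(S)\in\mathcal{L}(X_q)$ be $M_{p,q-p}(S\otimes_A1)M_{p,q-p}^{-1}$ if $0<p<q$,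 $\phi_q(a)$ if $p=0$ and $S$ is left multiplication by $a\in A$, and $S$ if $p=q$. Assume that $X$ is compactly aligned: $\iota_m^{m\vee n}(S_1)\,\iota_n^{m\vee n}(S_2)\in\mathcal{K}(X_{m\vee n})$ for all $m,n$, $S_1\in\mathcal{K}(X_m)$, $S_2\in\mathcal{K}(X_n)$. Put $I_0=A$, $I_n=\bigcap_{0<m\le n}\ker\phi_m$ for $n\neq0$, and $X_qI_r=\{\xi\in X_q:\langle\xi,\xi\rangle\in I_r\}$. For $S\in\mathcal{K}(X_p)$ let $\widetilde\iota_p^{\,n}(S)\in\bigoplus_{0\le q\le n}\mathcal{L}(X_qI_{n-q})$ be the element whose component at $q$ is $\iota_p^q(S)|_{X_qI_{n-q}}$ if $p\le q$ and $0$ otherwise. Let $C_n$ be the linear span of all $\widetilde\iota_p^{\,n}(S)$ with $p\le n$, $S\in\mathcal{K}(X_p)$, let $$\widetilde C_n=\Bigl\{\Bigl(\sum_{p\le n}\widetilde\iota_p^{\,q}(S_p)\Bigr)_{q\ge n}\in\prod_{q\ge n}C_q\ \Bigm|\ S_p\in\mathcal{K}(X_p)\text{ for }p\le n\Bigr\},$$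 and for $n\le m$ let $\widetilde j_{m,n}:\widetilde C_n\to\widetilde C_m$ be the map $$\Bigl(\sum_{p\le n}\widetilde\iota_p^{\,q}(S_p)\Bigr)_{q\ge n}\longmapsto\Bigl(\sum_{p\le n}\widetilde\iota_p^{\,q}(S_p)\Bigr)_{q\ge m}.$$ Then for all $n\le m$ in $\mathbb{N}^{\oplus k}$: 1. for all $S_p\in\mathcal{K}(X_p)$ $(p\le n)$, if $\sum_{p\le n}\widetilde\iota_p^{\,m}(S_p)=0$, then $\sum_{p\le n}\widetilde\iota_p^{\,n}(S_p)=0$; 2. the map $\widetilde j_{m,n}$ is injective. -/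

import Mathlib

/-!
Right Hilbert modules over a C*-algebra `A` are Mathlib's Hilbert C*-modules `CStarModule` over
the opposite algebra `Aᵐᵒᵖ`: the right action `ξ a` is `MulOpposite.op a • ξ`, and the axiom
`inner x (op a • y) = op a * inner x y` of `CStarModule Aᵐᵒᵖ E` reads `⟨x, y a⟩ = ⟨x, y⟩ a` in `A`.
-/

set_option linter.unusedSectionVars false

noncomputable section

namespace CNP

open MulOpposite

section Modules

variable (A : Type*) [NonUnitalCStarAlgebra A] [PartialOrder A] [StarOrderedRing A]

/-- The `A`-valued inner product of a right Hilbert `A`-module, conjugate linear in the first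
variable and (right) `A`-linear in the second one. -/
def rinner {E : Type*} [NormedAddCommGroup E] [NormedSpace ℂ E] [SMul Aᵐᵒᵖ E]
    [CStarModule Aᵐᵒᵖ E] (x y : E) : A :=
  unop (inner Aᵐᵒᵖ x y)

/-- A Hilbert `A`-bimodule: a (complete) right Hilbert `A`-module `E` with a `*`-homomorphism `φ`
from `A` to the adjointable operators on `E`. Neither injectivity nor nondegeneracy of `φ` is
required. -/
class HilbertBimodule (E : Type*) [NormedAddCommGroup E] [NormedSpace ℂ E] [CompleteSpace E]
    [SMul Aᵐᵒᵖ E] [CStarModule Aᵐᵒᵖ E] where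
  /-- the left action -/
  φ : A →ₙₐ[ℂ] (E →L[ℂ] E)
  /-- `φ (star a)` is the adjoint of `φ a` -/
  rinner_φ : ∀ (a : A) (x y : E), rinner A (φ a x) y = rinner A x (φ (star a) y)

section Right

variable {E : Type*} [NormedAddCommGroup E] [NormedSpace ℂ E] [SMul Aᵐᵒᵖ E] [CStarModule Aᵐᵒᵖ E]

theorem rinner_add_right (x y z : E) : rinner A x (y + z) = rinner A x y + rinner A x z := by
  simp [rinner]

theorem rinner_add_left (x y z : E) : rinner A (x + y) z = rinner A x z + rinner A y z := by
  simp [rinner]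

theorem rinner_smul_right (c : ℂ) (x y : E) : rinner A x (c • y) = c • rinner A x y := by
  simp [rinner]

theorem rinner_smul_left (c : ℂ) (x y : E) : rinner A (c • x) y = star c • rinner A x y := by
  simp [rinner]

theorem rinner_op_smul (a : A) (x y : E) : rinner A x (op a • y) = rinner A x y * a := by
  simp [rinner]

theorem star_rinner (x y : E) : star (rinner A x y) = rinner A y x := by
  rw [rinner, rinner, ← CStarModule.star_inner x y]
  rfl

theorem rinner_self_nonneg (x : E) : 0 ≤ rinner A x x :=
  CStarModule.inner_self_nonneg (A := Aᵐᵒᵖ) (x := x)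

theorem norm_sq_rinner (x : E) : ‖x‖ ^ 2 = ‖rinner A x x‖ :=
  CStarModule.norm_sq_eq Aᵐᵒᵖ

theorem norm_rinner_le (x y : E) : ‖rinner A x y‖ ≤ ‖x‖ * ‖y‖ :=
  CStarModule.norm_inner_le (A := Aᵐᵒᵖ) E

theorem rinner_ext {x y : E} (h : ∀ z, rinner A z x = rinner A z y) : x = y := by
  have h2 : rinner A (x - y) (x - y) = 0 := by
    have h3 := h (x - y)
    have h4 : rinner A (x - y) x = rinner A (x - y) (x - y) + rinner A (x - y) y := by
      rw [← rinner_add_right, sub_add_cancel]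
    rw [h4] at h3
    simpa using h3
  have h5 := norm_sq_rinner A (x - y)
  rw [h2, norm_zero] at h5
  exact sub_eq_zero.1 (norm_eq_zero.1 (by simpa using h5))

/-- The inner product as a continuous linear map in the second variable. -/
def rinnerRight (x : E) : E →L[ℂ] A :=
  LinearMap.mkContinuous
    { toFun := fun y => rinner A x y
      map_add' := rinner_add_right A x
      map_smul' := fun c y => rinner_smul_right A c x y } ‖x‖ (norm_rinner_le A x)

theorem continuous_rinner_right (x : E) : Continuous (fun y : E => rinner A x y) :=
  (rinnerRight A x).continuous

theorem continuous_rinner_left (y : E) : Continuous (fun x : E => rinner A x y) := by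
  have h : (fun x : E => rinner A x y) = fun x : E => star (rinner A y x) := by
    funext x
    rw [star_rinner]
  rw [h]
  exact (continuous_rinner_right A y).star

theorem op_smul_add (a : A) (x y : E) : op a • (x + y) = op a • x + (op a • y : E) := by
  refine rinner_ext A fun z => ?_
  simp [rinner_op_smul, rinner_add_right, add_mul]

theorem op_smul_smul (a : A) (c : ℂ) (x : E) : op a • (c • x) = c • (op a • x : E) := by
  refine rinner_ext A fun z => ?_
  simp only [rinner_op_smul, rinner_smul_right, smul_mul_assoc]

/-- The rank-one operator `θ_{ξ,η} ζ = ξ ⟨η, ζ⟩`. -/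
def rankOne (ξ η : E) : E →L[ℂ] E :=
  LinearMap.mkContinuous
    { toFun := fun ζ => op (rinner A η ζ) • ξ
      map_add' := fun x y => by
        refine rinner_ext A fun z => ?_
        simp only [rinner_op_smul, rinner_add_right, mul_add]
      map_smul' := fun c x => by
        refine rinner_ext A fun z => ?_
        simp only [rinner_op_smul, rinner_smul_right, mul_smul_comm, RingHom.id_apply] }
    (‖ξ‖ * ‖η‖) (fun ζ => by
      have key : ∀ (a : A) (v : E), ‖(op a • v : E)‖ ≤ ‖v‖ * ‖a‖ := fun a v => by
        have h1 : ‖(op a • v : E)‖ ^ 2 ≤ ‖(op a • v : E)‖ * (‖v‖ * ‖a‖) := by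
          rw [norm_sq_rinner A, rinner_op_smul]
          calc ‖rinner A (op a • v) v * a‖ ≤ ‖rinner A (op a • v) v‖ * ‖a‖ := norm_mul_le _ _
            _ ≤ (‖(op a • v : E)‖ * ‖v‖) * ‖a‖ := by
              gcongr
              exact norm_rinner_le A _ _
            _ = _ := by ring
        rcases (norm_nonneg (op a • v : E)).eq_or_lt with h0 | h0
        · rw [← h0]
          positivity
        · rw [sq] at h1
          exact le_of_mul_le_mul_left h1 h0
      calc ‖(op (rinner A η ζ) • ξ : E)‖ ≤ ‖ξ‖ * ‖rinner A η ζ‖ := key _ _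
        _ ≤ ‖ξ‖ * (‖η‖ * ‖ζ‖) := by
          gcongr
          exact norm_rinner_le A _ _
        _ = _ := by ring)

theorem rankOne_apply (ξ η ζ : E) : rankOne A ξ η ζ = op (rinner A η ζ) • ξ := rfl

/-- The compact operators `𝓚(E)`: the closed linear span of the rank-one operators, in the
operator norm. -/
def compacts (E : Type*) [NormedAddCommGroup E] [NormedSpace ℂ E] [SMul Aᵐᵒᵖ E]
    [CStarModule Aᵐᵒᵖ E] : Submodule ℂ (E →L[ℂ] E) :=
  (Submodule.span ℂ {T | ∃ ξ η : E, T = rankOne A ξ η}).topologicalClosure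

/-- The adjointable operators `𝓛(E)`. (A map with an adjoint is automatically linear and
bounded, and the adjoint is unique.) -/
def adjointables (E : Type*) [NormedAddCommGroup E] [NormedSpace ℂ E] [SMul Aᵐᵒᵖ E]
    [CStarModule Aᵐᵒᵖ E] : Subalgebra ℂ (E →L[ℂ] E) where
  carrier := {T | ∃ T' : E →L[ℂ] E, ∀ x y, rinner A (T x) y = rinner A x (T' y)}
  mul_mem' := by
    rintro S T ⟨S', hS⟩ ⟨T', hT⟩
    exact ⟨T' * S', fun x y => by simp [hS, hT]⟩
  add_mem' := by
    rintro S T ⟨S', hS⟩ ⟨T', hT⟩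
    exact ⟨S' + T', fun x y => by simp [hS, hT, rinner_add_left, rinner_add_right]⟩
  algebraMap_mem' := fun c =>
    ⟨star c • 1, fun x y => by
      simp [Algebra.algebraMap_eq_smul_one, rinner_smul_left, rinner_smul_right]⟩

variable {A}

theorem norm_adjoint_le {T T' : E →L[ℂ] E} (h : ∀ x y, rinner A (T x) y = rinner A x (T' y)) :
    ‖T'‖ ≤ ‖T‖ := by
  refine T'.opNorm_le_bound (norm_nonneg _) fun y => ?_
  have h1 : ‖T' y‖ ^ 2 ≤ ‖T' y‖ * (‖T‖ * ‖y‖) := by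
    rw [norm_sq_rinner A, ← h]
    calc _ ≤ ‖T (T' y)‖ * ‖y‖ := norm_rinner_le A _ _
      _ ≤ (‖T‖ * ‖T' y‖) * ‖y‖ := by
        gcongr
        exact T.le_opNorm _
      _ = _ := by ring
  rcases (norm_nonneg (T' y)).eq_or_lt with h0 | h0
  · rw [← h0]
    positivity
  · rw [sq] at h1
    exact le_of_mul_le_mul_left h1 h0

theorem isClosed_adjointables [CompleteSpace E] :
    IsClosed (adjointables A E : Set (E →L[ℂ] E)) := by
  refine IsSeqClosed.isClosed fun u T hu hT => ?_
  choose v hv using hu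
  have hcau : CauchySeq v := by
    refine Metric.cauchySeq_iff'.2 fun ε hε => ?_
    obtain ⟨N, hN⟩ := Metric.cauchySeq_iff'.1 hT.cauchySeq ε hε
    refine ⟨N, fun n hn => lt_of_le_of_lt ?_ (hN n hn)⟩
    rw [dist_eq_norm, dist_eq_norm]
    refine norm_adjoint_le (A := A) fun x y => ?_
    have e1 : (u n - u N) x = u n x + (-1 : ℂ) • u N x := by simp [sub_eq_add_neg]
    have e2 : (v n - v N) y = v n y + (-1 : ℂ) • v N y := by simp [sub_eq_add_neg]
    rw [e1, e2, rinner_add_left, rinner_add_right, rinner_smul_left, rinner_smul_right, hv, hv]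
    simp
  obtain ⟨T', hT'⟩ := cauchySeq_tendsto_of_complete hcau
  refine ⟨T', fun x y => ?_⟩
  have l1 : Filter.Tendsto (fun n => rinner A (u n x) y) Filter.atTop
      (nhds (rinner A (T x) y)) :=
    ((continuous_rinner_left A y).tendsto _).comp
      (((ContinuousLinearMap.apply ℂ E x).continuous.tendsto _).comp hT)
  have l2 : Filter.Tendsto (fun n => rinner A x (v n y)) Filter.atTop
      (nhds (rinner A x (T' y))) :=
    ((continuous_rinner_right A x).tendsto _).comp
      (((ContinuousLinearMap.apply ℂ E y).continuous.tendsto _).comp hT')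
  simp only [hv] at l1
  exact tendsto_nhds_unique l1 l2

theorem compacts_le_adjointables [CompleteSpace E] {S : E →L[ℂ] E} (hS : S ∈ compacts A E) :
    S ∈ adjointables A E := by
  have h : compacts A E ≤ Subalgebra.toSubmodule (adjointables A E) := by
    refine Submodule.topologicalClosure_minimal _ (Submodule.span_le.2 ?_) isClosed_adjointables
    rintro _ ⟨ξ, η, rfl⟩
    refine ⟨rankOne A η ξ, fun x y => ?_⟩
    rw [rankOne_apply, rankOne_apply, rinner_op_smul, ← star_rinner, rinner_op_smul, star_mul,
      star_rinner, star_rinner]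
  exact h hS

end Right

section Bimodule

variable {A}
variable {E : Type*} [NormedAddCommGroup E] [NormedSpace ℂ E] [CompleteSpace E] [SMul Aᵐᵒᵖ E]
  [CStarModule Aᵐᵒᵖ E] [HilbertBimodule A E]

variable (E) in
/-- The left action `φ_E : A → 𝓛(E)`. -/
def lact : A →ₙₐ[ℂ] (E →L[ℂ] E) := HilbertBimodule.φ

theorem rinner_lact (a : A) (x y : E) :
    rinner A (lact E a x) y = rinner A x (lact E (star a) y) :=
  HilbertBimodule.rinner_φ a x y

theorem lact_mem_adjointables (a : A) : lact E a ∈ adjointables A E :=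
  ⟨lact E (star a), rinner_lact a⟩

theorem lact_star_eq_zero {a : A} (h : lact E a = 0) : lact E (star a) = 0 := by
  ext y
  refine rinner_ext A fun x => ?_
  rw [← rinner_lact, h]
  simp [rinner]

theorem lact_mul_apply (a b : A) (x : E) : lact E (a * b) x = lact E a (lact E b x) := by
  rw [map_mul]
  rfl

variable {F : Type*} [NormedAddCommGroup F] [NormedSpace ℂ F] [SMul Aᵐᵒᵖ F] [CStarModule Aᵐᵒᵖ F]

theorem lact_rinner_eq_zero {y : F} (x : F) (hy : lact E (rinner A y y) = 0) :
    lact E (rinner A x y) = 0 := by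
  have hle : star (rinner A x y) * rinner A x y ≤ ‖x‖ ^ 2 • rinner A y y := by
    rw [star_rinner]
    exact CStarModule.inner_mul_inner_swap_le (A := Aᵐᵒᵖ) (x := x) (y := y)
  obtain ⟨d, hd⟩ := CStarAlgebra.nonneg_iff_eq_star_mul_self.1 (sub_nonneg.2 hle)
  have hc : (‖x‖ ^ 2 : ℝ) • rinner A y y = ((‖x‖ ^ 2 : ℝ) : ℂ) • rinner A y y :=
    (Complex.coe_smul _ _).symm
  have hsum : lact E (star (rinner A x y) * rinner A x y) + lact E (star d * d) = 0 := by
    rw [← map_add, ← hd, add_sub_cancel, hc, map_smul, hy, smul_zero]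
  ext z
  have h0 : rinner A (lact E (rinner A x y) z) (lact E (rinner A x y) z)
      + rinner A (lact E d z) (lact E d z) = 0 := by
    rw [rinner_lact, rinner_lact, ← lact_mul_apply, ← lact_mul_apply, ← rinner_add_right,
      ← add_apply, hsum]
    simp [rinner]
  have h1 : rinner A (lact E (rinner A x y) z) (lact E (rinner A x y) z) = 0 :=
    ((add_eq_zero_iff_of_nonneg (rinner_self_nonneg A _) (rinner_self_nonneg A _)).1 h0).1
  have h2 := norm_sq_rinner A (lact E (rinner A x y) z)
  rw [h1, norm_zero] at h2
  exact norm_eq_zero.1 (by simpa using h2)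

theorem exists_lact_bound (x : E) : ∃ C : ℝ, 0 ≤ C ∧
    ∀ a : A, ‖rinner A x (lact E a x)‖ ≤ C * ‖a‖ := by
  let f₀ : A →ₗ[ℂ] A :=
    { toFun := fun a => rinner A x (lact E a x)
      map_add' := fun a b => by simp [rinner_add_right]
      map_smul' := fun c a => by simp [rinner_smul_right] }
  let f : A →ₚ[ℂ] A := PositiveLinearMap.mk₀ f₀ (fun a ha => by
    obtain ⟨d, rfl⟩ := CStarAlgebra.nonneg_iff_eq_star_mul_self.1 ha
    change 0 ≤ rinner A x (lact E (star d * d) x)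
    rw [lact_mul_apply, ← rinner_lact]
    exact rinner_self_nonneg A _)
  obtain ⟨C, hC⟩ := PositiveLinearMap.exists_norm_apply_le f
  exact ⟨C, C.2, hC⟩

end Bimodule

end Modules

section ProductSystems

variable {A : Type*} [NonUnitalCStarAlgebra A] [PartialOrder A] [StarOrderedRing A]
variable {ι : Type*}
variable {X : (ι →₀ ℕ) → Type*} [∀ n, NormedAddCommGroup (X n)] [∀ n, NormedSpace ℂ (X n)]
  [∀ n, CompleteSpace (X n)] [∀ n, SMul Aᵐᵒᵖ (X n)] [∀ n, CStarModule Aᵐᵒᵖ (X n)]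
  [∀ n, HilbertBimodule A (X n)]

variable (A X) in
/-- A product system over `ℕ^{⊕ι}` (finitely supported families of natural numbers) of Hilbert
`A`-bimodules with fibres `X n`. The product `X m × X n → X (m + n)` is written with a free name
`l` for the degree `m + n`, so that associativity makes sense without transport. -/
structure ProductSystem where
  /-- the multiplication -/
  mul : ∀ {m n l : ι →₀ ℕ}, m + n = l → (X m →ₗ[ℂ] X n →ₗ[ℂ] X l)
  mul_assoc : ∀ {m n p mn np l : ι →₀ ℕ} (h₁ : m + n = mn) (h₂ : mn + p = l)
    (h₃ : n + p = np) (h₄ : m + np = l) (x : X m) (y : X n) (z : X p),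
    mul h₂ (mul h₁ x y) z = mul h₄ x (mul h₃ y z)
  /-- the identification of the identity fibre with the bimodule `A` -/
  unit : A ≃ₗ[ℂ] X 0
  rinner_unit : ∀ a b : A, rinner A (unit a) (unit b) = star a * b
  unit_op_smul : ∀ a b : A, op b • unit a = unit (a * b)
  lact_unit : ∀ a b : A, lact (X 0) a (unit b) = unit (a * b)
  /-- left multiplication by the identity fibre is the left action -/
  unit_mul : ∀ {n : ι →₀ ℕ} (a : A) (x : X n), mul (zero_add n) (unit a) x = lact (X n) a x
  /-- right multiplication by the identity fibre is the right action -/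
  mul_unit : ∀ {n : ι →₀ ℕ} (x : X n) (a : A), mul (add_zero n) x (unit a) = op a • x
  /-- For `m, n ≠ 0` the multiplication preserves the inner product of the balanced tensor
  product `X m ⊗_A X n` ... -/
  rinner_mul : ∀ {m n l : ι →₀ ℕ} (h : m + n = l), m ≠ 0 → n ≠ 0 →
    ∀ (x x' : X m) (y y' : X n),
      rinner A (mul h x y) (mul h x' y') = rinner A y (lact (X n) (rinner A x x') y')
  /-- ... and has dense range, so that it is an isomorphism of the (complete) Hilbert bimodules
  `X m ⊗_A X n ≅ X (m + n)`. -/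
  dense_mul : ∀ {m n l : ι →₀ ℕ} (h : m + n = l), m ≠ 0 → n ≠ 0 →
    (Submodule.span ℂ {z | ∃ (x : X m) (y : X n), z = mul h x y}).topologicalClosure = ⊤

namespace ProductSystem

variable (P : ProductSystem A X)

/-- The multiplication, as a linear map on the algebraic tensor product. -/
def tensorMul {m n l : ι →₀ ℕ} (h : m + n = l) : TensorProduct ℂ (X m) (X n) →ₗ[ℂ] X l :=
  TensorProduct.lift (P.mul h)

theorem denseRange_tensorMul {m n l : ι →₀ ℕ} (h : m + n = l) (hm : m ≠ 0) (hn : n ≠ 0) :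
    DenseRange (P.tensorMul h) := by
  have h1 := P.dense_mul h hm hn
  have h2 : Submodule.span ℂ {z | ∃ (x : X m) (y : X n), z = P.mul h x y}
      ≤ LinearMap.range (P.tensorMul h) := by
    refine Submodule.span_le.2 ?_
    rintro _ ⟨x, y, rfl⟩
    exact ⟨x ⊗ₜ y, by simp [tensorMul]⟩
  have h3 := Submodule.topologicalClosure_mono h2
  rw [h1, top_le_iff] at h3
  have h4 := Submodule.dense_iff_topologicalClosure_eq_top.2 h3
  rwa [LinearMap.coe_range] at h4

/-- The algebraic tensor `S ⊗ 1`, followed by the multiplication. -/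
def ampAlg {m n l : ι →₀ ℕ} (h : m + n = l) (S : X m →L[ℂ] X m) :
    TensorProduct ℂ (X m) (X n) →ₗ[ℂ] X l :=
  P.tensorMul h ∘ₗ LinearMap.rTensor (X n) (S : X m →ₗ[ℂ] X m)

theorem ampAlg_tmul {m n l : ι →₀ ℕ} (h : m + n = l) (S : X m →L[ℂ] X m) (x : X m) (y : X n) :
    P.ampAlg h S (x ⊗ₜ y) = P.mul h (S x) y := by
  simp [ampAlg, tensorMul]

theorem tensorMul_eq_ampAlg {m n l : ι →₀ ℕ} (h : m + n = l) (t : TensorProduct ℂ (X m) (X n)) :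
    P.tensorMul h t = P.ampAlg h 1 t := by
  induction t with
  | zero => simp
  | tmul x y => simp [ampAlg_tmul, tensorMul]
  | add s t hs ht => simp [hs, ht]

theorem rinner_ampAlg {m n l : ι →₀ ℕ} (h : m + n = l) (hm : m ≠ 0) (hn : n ≠ 0)
    {S S' : X m →L[ℂ] X m} (hS : ∀ x y, rinner A (S x) y = rinner A x (S' y))
    (U V : X m →L[ℂ] X m) (s t : TensorProduct ℂ (X m) (X n)) :
    rinner A (P.ampAlg h (S * U) s) (P.ampAlg h V t)
      = rinner A (P.ampAlg h U s) (P.ampAlg h (S' * V) t) := by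
  induction s with
  | zero => simp [rinner]
  | add s₁ s₂ h₁ h₂ => rw [map_add, map_add, rinner_add_left, rinner_add_left, h₁, h₂]
  | tmul x y =>
    induction t with
    | zero => simp [rinner]
    | add t₁ t₂ h₁ h₂ => rw [map_add, map_add, rinner_add_right, rinner_add_right, h₁, h₂]
    | tmul x' y' =>
      simp only [ampAlg_tmul]
      rw [P.rinner_mul h hm hn, P.rinner_mul h hm hn, mul_apply_eq_comp,
        mul_apply_eq_comp, hS]

theorem exists_ampAlg_bound {m n l : ι →₀ ℕ} (h : m + n = l) (hm : m ≠ 0) (hn : n ≠ 0)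
    (t : TensorProduct ℂ (X m) (X n)) :
    ∃ C : ℝ, 0 ≤ C ∧ ∀ S : X m →L[ℂ] X m, ‖P.ampAlg h S t‖ ≤ C * ‖S‖ := by
  induction t with
  | zero => exact ⟨0, le_rfl, fun S => by simp⟩
  | add s t hs ht =>
    obtain ⟨C, hC, h1⟩ := hs
    obtain ⟨D, hD, h2⟩ := ht
    refine ⟨C + D, add_nonneg hC hD, fun S => ?_⟩
    rw [map_add, add_mul]
    exact (norm_add_le _ _).trans (add_le_add (h1 S) (h2 S))
  | tmul x y =>
    obtain ⟨C, hC, h1⟩ := exists_lact_bound (A := A) y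
    refine ⟨√C * ‖x‖, by positivity, fun S => ?_⟩
    rw [ampAlg_tmul]
    refine le_of_sq_le_sq ?_ (by positivity)
    rw [norm_sq_rinner A, P.rinner_mul h hm hn]
    refine (h1 _).trans ?_
    rw [← norm_sq_rinner, mul_pow, mul_pow, Real.sq_sqrt hC, _root_.mul_assoc, ← mul_pow]
    gcongr
    rw [mul_comm]
    exact S.le_opNorm x

theorem growth_bound {x c C : ℝ} (hx : 0 ≤ x) (hc : 0 ≤ c) (a : ℕ → ℝ) (ha : ∀ k, 0 ≤ a k)
    (h1 : ∀ k, a k ^ 2 ≤ x * a (k + 1)) (h2 : ∀ k, a k ≤ C * c ^ (2 ^ k)) : a 0 ≤ x * c := by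
  rcases hx.eq_or_lt with rfl | hx
  · have := h1 0
    rw [zero_mul] at this ⊢
    nlinarith [ha 0]
  have h3 : ∀ k, a 0 ^ (2 ^ k) * x ≤ x ^ (2 ^ k) * a k := by
    intro k
    induction k with
    | zero => simp [mul_comm]
    | succ k ih =>
      have h4 : (a 0 ^ (2 ^ k) * x) ^ 2 ≤ (x ^ (2 ^ k) * a k) ^ 2 :=
        pow_le_pow_left₀ (mul_nonneg (pow_nonneg (ha 0) _) hx.le) ih 2
      have h5 : (x ^ (2 ^ k) * a k) ^ 2 ≤ (x ^ (2 ^ k)) ^ 2 * (x * a (k + 1)) := by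
        rw [mul_pow]
        gcongr
        exact h1 k
      have h6 : (a 0 ^ (2 ^ (k + 1)) * x) * x ≤ (x ^ (2 ^ (k + 1)) * a (k + 1)) * x := by
        calc (a 0 ^ (2 ^ (k + 1)) * x) * x = (a 0 ^ (2 ^ k) * x) ^ 2 := by ring
          _ ≤ (x ^ (2 ^ k)) ^ 2 * (x * a (k + 1)) := h4.trans h5
          _ = _ := by ring
      exact le_of_mul_le_mul_right h6 hx
  have h4 : ∀ k, a 0 ^ (2 ^ k) * x ≤ C * (x * c) ^ (2 ^ k) := fun k => by
    calc _ ≤ x ^ (2 ^ k) * a k := h3 k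
      _ ≤ x ^ (2 ^ k) * (C * c ^ (2 ^ k)) := by
        gcongr
        exact h2 k
      _ = _ := by ring
  by_contra! hlt
  rcases (mul_nonneg hx.le hc).eq_or_lt with h0 | h0
  · have h5 := h4 0
    rw [← h0] at h5 hlt
    simp only [pow_zero, pow_one, mul_zero] at h5
    nlinarith
  · have hr : 1 < a 0 / (x * c) := (one_lt_div h0).2 hlt
    obtain ⟨N, hN⟩ := pow_unbounded_of_one_lt (C / x) hr
    have h5 : C / x < (a 0 / (x * c)) ^ (2 ^ N) :=
      hN.trans_le (pow_le_pow_right₀ hr.le Nat.lt_two_pow_self.le)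
    rw [div_pow, div_lt_div_iff₀ hx (pow_pos h0 _)] at h5
    exact absurd (h4 N) (not_le.2 h5)

theorem norm_ampAlg_le {m n l : ι →₀ ℕ} (h : m + n = l) (hm : m ≠ 0) (hn : n ≠ 0)
    {S S' : X m →L[ℂ] X m} (hS : ∀ x y, rinner A (S x) y = rinner A x (S' y))
    (t : TensorProduct ℂ (X m) (X n)) :
    ‖P.ampAlg h S t‖ ≤ √‖S' * S‖ * ‖P.tensorMul h t‖ := by
  rw [tensorMul_eq_ampAlg]
  set H : X m →L[ℂ] X m := S' * S with hH
  have hself : ∀ x y, rinner A (H x) y = rinner A x (H y) := fun x y => by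
    rw [hH, mul_apply_eq_comp, mul_apply_eq_comp, ← hS, ← star_rinner,
      ← hS, star_rinner]
  have hpow : ∀ (N : ℕ) (x y : X m), rinner A ((H ^ N) x) y = rinner A x ((H ^ N) y) := by
    intro N
    induction N with
    | zero => intro x y; simp
    | succ N ih =>
      intro x y
      rw [pow_succ, mul_apply_eq_comp, ih, hself, ← mul_apply_eq_comp,
        ← pow_succ', pow_succ]
  obtain ⟨C, hC, hb⟩ := P.exists_ampAlg_bound h hm hn t
  have key : ‖P.ampAlg h H t‖ ≤ ‖P.ampAlg h 1 t‖ * ‖H‖ := by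
    have := growth_bound (C := C) (norm_nonneg (P.ampAlg h 1 t)) (norm_nonneg H)
      (fun k => ‖P.ampAlg h (H ^ (2 ^ k)) t‖) (fun k => norm_nonneg _) (fun k => by
        have e := P.rinner_ampAlg h hm hn (hpow (2 ^ k)) 1 (H ^ (2 ^ k)) t t
        rw [mul_one, ← pow_add, ← two_mul, ← pow_succ'] at e
        rw [norm_sq_rinner A, e]
        exact norm_rinner_le A _ _) (fun k => by
        refine (hb _).trans ?_
        gcongr
        exact norm_pow_le' H (by positivity))
    simpa using this
  refine le_of_sq_le_sq ?_ (by positivity)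
  have e := P.rinner_ampAlg h hm hn hS 1 S t t
  rw [mul_one, ← hH] at e
  rw [norm_sq_rinner A, e, mul_pow, Real.sq_sqrt (norm_nonneg _)]
  calc _ ≤ ‖P.ampAlg h 1 t‖ * ‖P.ampAlg h H t‖ := norm_rinner_le A _ _
    _ ≤ ‖P.ampAlg h 1 t‖ * (‖P.ampAlg h 1 t‖ * ‖H‖) := by gcongr
    _ = _ := by ring

/-- For `m, n ≠ 0` and `S` an operator on `X m`, the operator `M ∘ (S ⊗ 1) ∘ M⁻¹` on `X (m + n)`,
where `M : X m ⊗_A X n ≅ X (m + n)` is the multiplication: the continuous extension of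
`∑ xᵢ yᵢ ↦ ∑ (S xᵢ) yᵢ`. It is used for adjointable `S` only, where it is characterized by
`amp_mul`. -/
def amp {m n l : ι →₀ ℕ} (h : m + n = l) (S : X m →L[ℂ] X m) : X l →L[ℂ] X l :=
  (P.ampAlg h S).extendOfNorm (P.tensorMul h)

theorem amp_tensorMul {m n l : ι →₀ ℕ} (h : m + n = l) (hm : m ≠ 0) (hn : n ≠ 0)
    {S : X m →L[ℂ] X m} (hS : S ∈ adjointables A (X m)) (t : TensorProduct ℂ (X m) (X n)) :
    P.amp h S (P.tensorMul h t) = P.ampAlg h S t := by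
  obtain ⟨S', hS'⟩ := hS
  exact LinearMap.extendOfNorm_eq (P.denseRange_tensorMul h hm hn)
    ⟨_, P.norm_ampAlg_le h hm hn hS'⟩ t

theorem amp_mul {m n l : ι →₀ ℕ} (h : m + n = l) (hm : m ≠ 0) (hn : n ≠ 0)
    {S : X m →L[ℂ] X m} (hS : S ∈ adjointables A (X m)) (x : X m) (y : X n) :
    P.amp h S (P.mul h x y) = P.mul h (S x) y := by
  have := P.amp_tensorMul h hm hn hS (x ⊗ₜ y)
  rwa [ampAlg_tmul, tensorMul, TensorProduct.lift.tmul] at this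

theorem ext_of_mul {m n l : ι →₀ ℕ} (h : m + n = l) (hm : m ≠ 0) (hn : n ≠ 0)
    {T T' : X l →L[ℂ] X l} (hT : ∀ x y, T (P.mul h x y) = T' (P.mul h x y)) : T = T' := by
  refine DFunLike.coe_injective ((P.denseRange_tensorMul h hm hn).equalizer T.continuous
    T'.continuous (funext fun t => ?_))
  simp only [Function.comp_apply]
  induction t with
  | zero => simp
  | tmul x y => simpa [tensorMul] using hT x y
  | add s t hs ht => rw [map_add, map_add, map_add, hs, ht]

theorem amp_mem_adjointables {m n l : ι →₀ ℕ} (h : m + n = l) (hm : m ≠ 0) (hn : n ≠ 0)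
    {S : X m →L[ℂ] X m} (hS : S ∈ adjointables A (X m)) : P.amp h S ∈ adjointables A (X l) := by
  obtain ⟨S', hS'⟩ := id hS
  have hS2 : S' ∈ adjointables A (X m) :=
    ⟨S, fun x y => by rw [← star_rinner, ← hS', star_rinner]⟩
  refine ⟨P.amp h S', fun u v => ?_⟩
  refine (P.denseRange_tensorMul h hm hn).induction_on (p := fun u =>
    rinner A (P.amp h S u) v = rinner A u (P.amp h S' v)) u (isClosed_eq
      ((continuous_rinner_left A v).comp (P.amp h S).continuous)
      (continuous_rinner_left A _)) fun s => ?_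
  refine (P.denseRange_tensorMul h hm hn).induction_on (p := fun v =>
    rinner A (P.amp h S (P.tensorMul h s)) v = rinner A (P.tensorMul h s) (P.amp h S' v)) v
      (isClosed_eq (continuous_rinner_right A _)
      ((continuous_rinner_right A _).comp (P.amp h S').continuous)) fun t => ?_
  rw [P.amp_tensorMul h hm hn hS, P.amp_tensorMul h hm hn hS2, tensorMul_eq_ampAlg,
    tensorMul_eq_ampAlg]
  have e := P.rinner_ampAlg h hm hn hS' 1 1 s t
  rwa [mul_one, mul_one] at e

theorem norm_unit (a : A) : ‖P.unit a‖ = ‖a‖ := by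
  have h := norm_sq_rinner A (P.unit a)
  rw [P.rinner_unit, CStarRing.norm_star_mul_self, ← sq] at h
  exact (sq_eq_sq₀ (norm_nonneg _) (norm_nonneg _)).1 h

theorem norm_lact_zero (P : ProductSystem A X) (a : A) : ‖lact (X 0) a‖ = ‖a‖ := by
  refine le_antisymm ((lact (X 0) a).opNorm_le_bound (norm_nonneg _) fun x => ?_) ?_
  · obtain ⟨b, rfl⟩ := P.unit.surjective x
    rw [P.lact_unit, norm_unit, norm_unit]
    exact norm_mul_le a b
  · have h1 := (lact (X 0) a).le_opNorm (P.unit (star a))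
    rw [P.lact_unit, norm_unit, norm_unit, CStarRing.norm_self_mul_star, norm_star] at h1
    rcases (norm_nonneg a).eq_or_lt with h0 | h0
    · rw [← h0]
      exact norm_nonneg _
    · exact le_of_mul_le_mul_right h1 h0

theorem lact_zero_injective (P : ProductSystem A X) : Function.Injective (lact (A := A) (X 0)) := by
  intro a b hab
  have h := P.norm_lact_zero (a - b)
  rw [map_sub, hab, sub_self, norm_zero] at h
  exact sub_eq_zero.1 (norm_eq_zero.1 h.symm)

/-- Every compact operator on the identity fibre `A` is left multiplication by an element
of `A`. -/
theorem exists_lact_eq (P : ProductSystem A X) (S : compacts A (X 0)) : ∃ a : A, lact (X 0) a = S := by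
  let f : A →ₗᵢ[ℂ] (X 0 →L[ℂ] X 0) :=
    { toFun := fun a => lact (X 0) a
      map_add' := fun a b => map_add _ a b
      map_smul' := fun c a => map_smul _ c a
      norm_map' := P.norm_lact_zero }
  have h : compacts A (X 0) ≤ LinearMap.range f.toLinearMap := by
    refine Submodule.topologicalClosure_minimal _ (Submodule.span_le.2 ?_) ?_
    · rintro _ ⟨ξ, η, rfl⟩
      obtain ⟨a, rfl⟩ := P.unit.surjective ξ
      obtain ⟨b, rfl⟩ := P.unit.surjective η
      refine ⟨a * star b, ?_⟩
      ext x
      obtain ⟨c, rfl⟩ := P.unit.surjective x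
      change lact (X 0) (a * star b) (P.unit c) = _
      rw [P.lact_unit, rankOne_apply, P.rinner_unit, P.unit_op_smul, _root_.mul_assoc]
    · exact f.isometry.isClosedEmbedding.isClosed_range
  obtain ⟨a, ha⟩ := h S.2
  exact ⟨a, ha⟩

/-- The homomorphism `ι_p^q : 𝓚(X p) → 𝓛(X q)` for `p ≤ q`: it is `φ_q(a)` for `p = 0` and
`S = L_a`, it is `S` for `p = q`, and it is `M ∘ (S ⊗ 1) ∘ M⁻¹` for `0 < p < q`. -/
def iota {p q : ι →₀ ℕ} (h : p ≤ q) (S : compacts A (X p)) : X q →L[ℂ] X q :=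
  open scoped Classical in
  if h0 : p = 0 then
    lact (X q) (P.exists_lact_eq (h0 ▸ S)).choose
  else if hpq : p = q then
    hpq ▸ (S : X p →L[ℂ] X p)
  else P.amp (add_tsub_cancel_of_le h) S

theorem iota_zero {q : ι →₀ ℕ} (h : 0 ≤ q) (S : compacts A (X 0)) {a : A}
    (ha : lact (X 0) a = S) : P.iota h S = lact (X q) a := by
  have e := (P.exists_lact_eq S).choose_spec.trans ha.symm
  rw [iota, dif_pos rfl]
  exact congrArg _ (P.lact_zero_injective e)

theorem iota_self {p : ι →₀ ℕ} (S : compacts A (X p)) : P.iota le_rfl S = S := by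
  by_cases h0 : p = 0
  · subst h0
    obtain ⟨a, ha⟩ := P.exists_lact_eq S
    rw [P.iota_zero _ S ha, ha]
  · rw [iota, dif_neg h0, dif_pos rfl]

theorem iota_of_lt {p q : ι →₀ ℕ} (h : p ≤ q) (h0 : p ≠ 0) (hpq : p ≠ q)
    (S : compacts A (X p)) : P.iota h S = P.amp (add_tsub_cancel_of_le h) S := by
  rw [iota, dif_neg h0, dif_neg hpq]

theorem tsub_ne_zero_of {p q : ι →₀ ℕ} (h : p ≤ q) (hpq : p ≠ q) : q - p ≠ 0 := fun h0 =>
  hpq (le_antisymm h (tsub_eq_zero_iff_le.1 h0))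

/-- For `0 < p < q` the operator `ι_p^q(S)` is the one with `ι_p^q(S)(xy) = (Sx)y`. -/
theorem iota_mul {p q : ι →₀ ℕ} (h : p ≤ q) (h0 : p ≠ 0) (hpq : p ≠ q) (S : compacts A (X p))
    (x : X p) (y : X (q - p)) :
    P.iota h S (P.mul (add_tsub_cancel_of_le h) x y)
      = P.mul (add_tsub_cancel_of_le h) ((S : X p →L[ℂ] X p) x) y := by
  rw [P.iota_of_lt h h0 hpq]
  exact P.amp_mul _ h0 (tsub_ne_zero_of h hpq) (compacts_le_adjointables S.2) x y

theorem iota_mem_adjointables {p q : ι →₀ ℕ} (h : p ≤ q) (S : compacts A (X p)) :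
    P.iota h S ∈ adjointables A (X q) := by
  by_cases h0 : p = 0
  · subst h0
    obtain ⟨a, ha⟩ := P.exists_lact_eq S
    rw [P.iota_zero _ S ha]
    exact lact_mem_adjointables a
  · by_cases hpq : p = q
    · subst hpq
      rw [iota_self]
      exact compacts_le_adjointables S.2
    · rw [P.iota_of_lt h h0 hpq]
      exact P.amp_mem_adjointables _ h0 (tsub_ne_zero_of h hpq) (compacts_le_adjointables S.2)

theorem iota_add {p q : ι →₀ ℕ} (h : p ≤ q) (S T : compacts A (X p)) :
    P.iota h (S + T) = P.iota h S + P.iota h T := by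
  by_cases h0 : p = 0
  · subst h0
    obtain ⟨a, ha⟩ := P.exists_lact_eq S
    obtain ⟨b, hb⟩ := P.exists_lact_eq T
    rw [P.iota_zero _ S ha, P.iota_zero _ T hb,
      P.iota_zero _ (S + T) (a := a + b) (by rw [map_add, ha, hb]; rfl), map_add]
  · by_cases hpq : p = q
    · subst hpq
      rw [iota_self, iota_self, iota_self]
      rfl
    · refine P.ext_of_mul (add_tsub_cancel_of_le h) h0 (tsub_ne_zero_of h hpq) fun x y => ?_
      rw [P.iota_mul h h0 hpq, add_apply, P.iota_mul h h0 hpq,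
        P.iota_mul h h0 hpq]
      simp

theorem iota_smul {p q : ι →₀ ℕ} (h : p ≤ q) (c : ℂ) (S : compacts A (X p)) :
    P.iota h (c • S) = c • P.iota h S := by
  by_cases h0 : p = 0
  · subst h0
    obtain ⟨a, ha⟩ := P.exists_lact_eq S
    rw [P.iota_zero _ S ha,
      P.iota_zero _ (c • S) (a := c • a) (by rw [map_smul, ha]; rfl), map_smul]
  · by_cases hpq : p = q
    · subst hpq
      rw [iota_self, iota_self]
      rfl
    · refine P.ext_of_mul (add_tsub_cancel_of_le h) h0 (tsub_ne_zero_of h hpq) fun x y => ?_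
      rw [P.iota_mul h h0 hpq, smul_apply, P.iota_mul h h0 hpq]
      simp

/-- `X` is compactly aligned if `ι_m^{m ∨ n}(S₁) ι_n^{m ∨ n}(S₂)` is compact for all compact
`S₁`, `S₂`. -/
def CompactlyAligned : Prop :=
  ∀ (m n : ι →₀ ℕ) (S₁ : compacts A (X m)) (S₂ : compacts A (X n)),
    P.iota (le_sup_left : m ≤ m ⊔ n) S₁ * P.iota (le_sup_right : n ≤ m ⊔ n) S₂
      ∈ compacts A (X (m ⊔ n))

variable (A X) in
/-- The ideal `I_n = ⋂_{0 < m ≤ n} ker φ_m` of `A`. For `n = 0` the intersection is empty,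
so that `I_0 = A`. -/
def kerIdeal (n : ι →₀ ℕ) : Set A := {a | ∀ m, 0 < m → m ≤ n → lact (X m) a = 0}

variable (A X) in
/-- The submodule `X_q I_r = {ξ ∈ X_q | ⟨ξ, ξ⟩ ∈ I_r}`. -/
def fibreIdeal (q r : ι →₀ ℕ) : Submodule ℂ (X q) where
  carrier := {ξ | rinner A ξ ξ ∈ kerIdeal A X r}
  zero_mem' := fun m _ _ => by simp [rinner]
  add_mem' := fun {x y} hx hy m h0 hm => by
    rw [rinner_add_right, map_add, lact_rinner_eq_zero (x + y) (hx m h0 hm),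
      lact_rinner_eq_zero (x + y) (hy m h0 hm), add_zero]
  smul_mem' := fun c x hx m h0 hm => by
    rw [rinner_smul_right, map_smul, lact_rinner_eq_zero (c • x) (hx m h0 hm), smul_zero]

theorem mapsTo_fibreIdeal {q : ι →₀ ℕ} (r : ι →₀ ℕ) {T : X q →L[ℂ] X q}
    (hT : T ∈ adjointables A (X q)) {ξ : X q} (hξ : ξ ∈ fibreIdeal A X q r) :
    T ξ ∈ fibreIdeal A X q r := by
  obtain ⟨T', hT'⟩ := hT
  intro m h0 hm
  have h := lact_star_eq_zero (lact_rinner_eq_zero (T' (T ξ)) (hξ m h0 hm))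
  rwa [star_rinner, ← hT'] at h

/-- The restriction `ι_p^q(S)|_{X_q I_r}`, an operator on `X_q I_r`. -/
def iotaRestrict {p q : ι →₀ ℕ} (r : ι →₀ ℕ) (h : p ≤ q) (S : compacts A (X p)) :
    fibreIdeal A X q r →L[ℂ] fibreIdeal A X q r :=
  ((P.iota h S).comp (fibreIdeal A X q r).subtypeL).codRestrict _
    fun ξ => mapsTo_fibreIdeal r (P.iota_mem_adjointables h S) ξ.2

theorem iotaRestrict_apply {p q : ι →₀ ℕ} (r : ι →₀ ℕ) (h : p ≤ q) (S : compacts A (X p))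
    (ξ : fibreIdeal A X q r) : (P.iotaRestrict r h S ξ : X q) = P.iota h S ξ := rfl

variable (A X) in
/-- The direct sum `⨁_{0 ≤ q ≤ n}` of the operators on `X_q I_{n-q}`. There are finitely many
`q ≤ n`, so that this is the product. (It contains `⨁_{0 ≤ q ≤ n} 𝓛(X_q I_{n-q})`, in which all
the operators below lie, since they are restrictions of adjointable operators whose adjoints
leave `X_q I_{n-q}` invariant, too.) -/
def OpSum (n : ι →₀ ℕ) : Type _ :=
  (q : Set.Iic n) → (fibreIdeal A X q.1 (n - q.1) →L[ℂ] fibreIdeal A X q.1 (n - q.1))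

instance (n : ι →₀ ℕ) : AddCommGroup (OpSum A X n) :=
  inferInstanceAs (AddCommGroup ((q : Set.Iic n) →
    (fibreIdeal A X q.1 (n - q.1) →L[ℂ] fibreIdeal A X q.1 (n - q.1))))

instance (n : ι →₀ ℕ) : Module ℂ (OpSum A X n) :=
  inferInstanceAs (Module ℂ ((q : Set.Iic n) →
    (fibreIdeal A X q.1 (n - q.1) →L[ℂ] fibreIdeal A X q.1 (n - q.1))))

variable (A X) in
/-- The component at `q ≤ n`. -/
def OpSum.component {n : ι →₀ ℕ} (q : Set.Iic n) :
    OpSum A X n →ₗ[ℂ] (fibreIdeal A X q.1 (n - q.1) →L[ℂ] fibreIdeal A X q.1 (n - q.1)) where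
  toFun T := T q
  map_add' _ _ := rfl
  map_smul' _ _ := rfl

theorem OpSum.ext_component {n : ι →₀ ℕ} {T T' : OpSum A X n}
    (h : ∀ q, OpSum.component A X q T = OpSum.component A X q T') : T = T' :=
  funext h

/-- The operator `ι̃_p^n(S)`: its component at `q ≤ n` is the restriction of `ι_p^q(S)` to
`X_q I_{n-q}` if `p ≤ q`, and `0` otherwise. -/
def iotaTilde (p n : ι →₀ ℕ) (S : compacts A (X p)) : OpSum A X n :=
  open scoped Classical in
  fun q => if h : p ≤ q.1 then P.iotaRestrict (n - q.1) h S else 0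

theorem component_iotaTilde_of_le {p n : ι →₀ ℕ} (S : compacts A (X p)) (q : Set.Iic n)
    (h : p ≤ q.1) :
    OpSum.component A X q (P.iotaTilde p n S) = P.iotaRestrict (n - q.1) h S :=
  dif_pos h

theorem component_iotaTilde_of_not_le {p n : ι →₀ ℕ} (S : compacts A (X p)) (q : Set.Iic n)
    (h : ¬ p ≤ q.1) : OpSum.component A X q (P.iotaTilde p n S) = 0 :=
  dif_neg h

theorem iotaTilde_add (p n : ι →₀ ℕ) (S T : compacts A (X p)) :
    P.iotaTilde p n (S + T) = P.iotaTilde p n S + P.iotaTilde p n T := by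
  refine OpSum.ext_component fun q => ?_
  rw [map_add]
  by_cases h : p ≤ q.1
  · rw [P.component_iotaTilde_of_le _ q h, P.component_iotaTilde_of_le _ q h,
      P.component_iotaTilde_of_le _ q h]
    ext ξ
    simp [iotaRestrict_apply, iota_add]
  · rw [P.component_iotaTilde_of_not_le _ q h, P.component_iotaTilde_of_not_le _ q h,
      P.component_iotaTilde_of_not_le _ q h, add_zero]

theorem iotaTilde_smul (p n : ι →₀ ℕ) (c : ℂ) (S : compacts A (X p)) :
    P.iotaTilde p n (c • S) = c • P.iotaTilde p n S := by
  refine OpSum.ext_component fun q => ?_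
  rw [map_smul]
  by_cases h : p ≤ q.1
  · rw [P.component_iotaTilde_of_le _ q h, P.component_iotaTilde_of_le _ q h]
    ext ξ
    simp [iotaRestrict_apply, iota_smul]
  · rw [P.component_iotaTilde_of_not_le _ q h, P.component_iotaTilde_of_not_le _ q h]
    ext ξ
    simp

theorem iotaTilde_zero (p n : ι →₀ ℕ) : P.iotaTilde p n 0 = 0 := by
  have h := P.iotaTilde_smul p n 0 0
  rwa [zero_smul, zero_smul] at h

/-- The algebra `C_n`: the linear span of all `ι̃_p^n(S)` with `p ≤ n` and `S ∈ 𝓚(X p)`. -/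
def C (n : ι →₀ ℕ) : Submodule ℂ (OpSum A X n) :=
  Submodule.span ℂ {T | ∃ p ≤ n, ∃ S : compacts A (X p), T = P.iotaTilde p n S}

variable [DecidableEq ι]

/-- The algebra `C̃_n` of all families `(∑_{p ≤ n} ι̃_p^q(S_p))_{q ≥ n}` in `∏_{q ≥ n} C_q`, with
`S_p ∈ 𝓚(X p)` for `p ≤ n` (the values `S_p` at other `p` play no role). -/
def CTilde (n : ι →₀ ℕ) : Submodule ℂ ((q : Set.Ici n) → P.C q.1) where
  carrier := {f | ∃ S : (p : ι →₀ ℕ) → compacts A (X p), ∀ q : Set.Ici n,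
    ((f q : P.C q.1) : OpSum A X q.1) = ∑ p ∈ Finset.Iic n, P.iotaTilde p q.1 (S p)}
  zero_mem' := by
    refine ⟨0, fun q => ?_⟩
    exact (Finset.sum_eq_zero fun p _ => P.iotaTilde_zero p q.1).symm
  add_mem' := by
    rintro f g ⟨S, hS⟩ ⟨T, hT⟩
    refine ⟨S + T, fun q => ?_⟩
    rw [Pi.add_apply, Submodule.coe_add, hS, hT, ← Finset.sum_add_distrib]
    exact Finset.sum_congr rfl fun p _ => (P.iotaTilde_add p q.1 (S p) (T p)).symm
  smul_mem' := by
    rintro c f ⟨S, hS⟩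
    refine ⟨c • S, fun q => ?_⟩
    rw [Pi.smul_apply, Submodule.coe_smul, hS, Finset.smul_sum]
    exact Finset.sum_congr rfl fun p _ => (P.iotaTilde_smul p q.1 c (S p)).symm

theorem exists_extend_family {n m : ι →₀ ℕ} (h : n ≤ m) (S : (p : ι →₀ ℕ) → compacts A (X p)) :
    ∃ T : (p : ι →₀ ℕ) → compacts A (X p), ∀ q, ∑ p ∈ Finset.Iic m, P.iotaTilde p q (T p)
      = ∑ p ∈ Finset.Iic n, P.iotaTilde p q (S p) := by
  classical
  refine ⟨fun p => if p ≤ n then S p else 0, fun q => ?_⟩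
  have hsub : Finset.Iic n ⊆ Finset.Iic m := Finset.Iic_subset_Iic.2 h
  rw [← Finset.sum_subset hsub fun p _ hp => ?_]
  · refine Finset.sum_congr rfl fun p hp => ?_
    simp only [if_pos (Finset.mem_Iic.1 hp)]
  · simp only [if_neg fun hpn => hp (Finset.mem_Iic.2 hpn), iotaTilde_zero]

/-- The connecting map `j̃_{m,n} : C̃_n → C̃_m` for `n ≤ m`, which sends the family
`(∑_{p ≤ n} ι̃_p^q(S_p))_{q ≥ n}` to `(∑_{p ≤ n} ι̃_p^q(S_p))_{q ≥ m}`. -/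
def jTilde {n m : ι →₀ ℕ} (h : n ≤ m) : P.CTilde n →ₗ[ℂ] P.CTilde m where
  toFun f := ⟨fun q => f.1 ⟨q.1, h.trans q.2⟩, by
    obtain ⟨S, hS⟩ := f.2
    obtain ⟨T, hT⟩ := P.exists_extend_family h S
    exact ⟨T, fun q => by rw [hT]; exact hS ⟨q.1, h.trans q.2⟩⟩⟩
  map_add' _ _ := rfl
  map_smul' _ _ := rfl

theorem coe_jTilde_apply {n m : ι →₀ ℕ} (h : n ≤ m) (f : P.CTilde n) (q : Set.Ici m) :
    (P.jTilde h f).1 q = f.1 ⟨q.1, h.trans q.2⟩ := rfl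

end ProductSystem

end ProductSystems

end CNP

end

noncomputable section

namespace CNP

open MulOpposite

section Modules

variable {A : Type*} [NonUnitalCStarAlgebra A] [PartialOrder A] [StarOrderedRing A]
variable {E : Type*} [NormedAddCommGroup E] [NormedSpace ℂ E] [SMul Aᵐᵒᵖ E] [CStarModule Aᵐᵒᵖ E]

/-! The heart is the passage from level `n + e` down to level `n`, where `e` is a generator of the
semigroup. Fix `q ≤ n` and `ξ ∈ X_q I_{n-q}`, and let `T` be the sum of the `ι_p^q(S_p)` over `p ≤
n` with `p ≤ q`. The hypothesis kills `T` only on the smaller module `X_q I_{n+e-q}`, so the point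
is that `Tξ` lies there, even though `ξ` need not. This means that `a = ⟨Tξ, Tξ⟩ ∈ I_{n-q}` also
acts as zero on `X_e`.

If `q_i < n_i` in the direction `i` of `e`, this is part of `a ∈ I_{n-q}`. If `q_i = n_i`, every `p
≤ n` below `q + e` is already below `q`, so the sum at `q + e` acts on `X_q X_e` as `T ⊗ 1`
(`iotaSum_mul`). For `y ∈ X_e I_{n-q}` the product `ξy` lies in `X_{q+e} I_{n-q}`, and `n - q =
(n+e) - (q+e)`. Hence `(Tξ)y = 0` and `ay = 0`, and `lact_eq_zero_of_fibreIdeal` extends this to all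
of `X_e`.

Now `T*Tξ` lies in `X_q I_{n+e-q}` too, so `TT*Tξ = 0`, and taking inner products twice yields `T*Tξ
= 0` and `Tξ = 0`. Iterating over generators gives the first claim. The second follows by comparing
the levels `q` and `q ∨ m`. -/

theorem rinner_zero_left (x : E) : rinner A 0 x = 0 := by simp [rinner]

theorem rinner_zero_right (x : E) : rinner A x 0 = 0 := by simp [rinner]

theorem eq_zero_of_rinner_self {x : E} (h : rinner A x x = 0) : x = 0 := by
  have h2 := norm_sq_rinner A x
  rw [h, norm_zero] at h2
  exact norm_eq_zero.1 (by simpa using h2)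

end Modules

namespace ProductSystem

variable {A : Type*} [NonUnitalCStarAlgebra A] [PartialOrder A] [StarOrderedRing A]
variable {ι : Type*}
variable {X : (ι →₀ ℕ) → Type*} [∀ n, NormedAddCommGroup (X n)] [∀ n, NormedSpace ℂ (X n)]
  [∀ n, CompleteSpace (X n)] [∀ n, SMul Aᵐᵒᵖ (X n)] [∀ n, CStarModule Aᵐᵒᵖ (X n)]
  [∀ n, HilbertBimodule A (X n)]
variable (P : ProductSystem A X)

/-! ### Products of fibres and the maps `ι_p^q` -/

theorem lact_mul {m n l : ι →₀ ℕ} (h : m + n = l) (a : A) (x : X m) (y : X n) :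
    lact (X l) a (P.mul h x y) = P.mul h (lact (X m) a x) y := by
  rw [← P.unit_mul, ← P.unit_mul, P.mul_assoc (zero_add m) h h (zero_add l)]

/-- The inner product formula for products, which for degree `0` in the first factor follows from
the bimodule structure. -/
theorem rinner_mul_mul {m n l : ι →₀ ℕ} (h : m + n = l) (hn : n ≠ 0) (x x' : X m) (y y' : X n) :
    rinner A (P.mul h x y) (P.mul h x' y') = rinner A y (lact (X n) (rinner A x x') y') := by
  by_cases hm : m = 0
  · subst hm
    obtain rfl : n = l := by simpa using h
    obtain ⟨a, rfl⟩ := P.unit.surjective x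
    obtain ⟨b, rfl⟩ := P.unit.surjective x'
    rw [P.unit_mul, P.unit_mul, P.rinner_unit, rinner_lact, lact_mul_apply]
  · exact P.rinner_mul h hm hn x x' y y'

/-- Right multiplication by a fixed element of a fibre of nonzero degree, as a continuous linear
map. -/
def mulRight {m n l : ι →₀ ℕ} (h : m + n = l) (hn : n ≠ 0) (y : X n) : X m →L[ℂ] X l :=
  LinearMap.mkContinuousOfExistsBound ((P.mul h).flip y) (by
    -- `⟨xy, xy⟩ = ⟨y, ⟨x, x⟩y⟩`, and the positive map `a ↦ ⟨y, ay⟩` is bounded by some `C`; hence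
    -- `‖xy‖ ≤ √C ‖x‖`.
    obtain ⟨C, hC, h1⟩ := exists_lact_bound (A := A) y
    refine ⟨√C, fun x => ?_⟩
    refine le_of_sq_le_sq ?_ (by positivity)
    rw [LinearMap.flip_apply, norm_sq_rinner A, P.rinner_mul_mul h hn, mul_pow, Real.sq_sqrt hC,
      norm_sq_rinner A x]
    exact h1 _)

theorem mulRight_apply {m n l : ι →₀ ℕ} (h : m + n = l) (hn : n ≠ 0) (x : X m) (y : X n) :
    P.mulRight h hn y x = P.mul h x y := rfl

theorem iota_mul_of_add_eq {p d q : ι →₀ ℕ} (h : p + d = q) (hpq : p ≤ q) (h0 : p ≠ 0)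
    (hd : d ≠ 0) (S : compacts A (X p)) (x : X p) (y : X d) :
    P.iota hpq S (P.mul h x y) = P.mul h ((S : X p →L[ℂ] X p) x) y := by
  obtain rfl : d = q - p := by rw [← h, add_tsub_cancel_left]
  refine P.iota_mul hpq h0 (fun he => hd ?_) S x y
  rw [he, tsub_self]

/-- For `0 < p < q` the products `uv` with `u ∈ X_p` span a dense subspace of `X_q`, and on them
`(uv)y = u(vy)` turns both sides into `(Su)(vy)`. Continuity of right multiplication by `y` does the
rest. -/
theorem iota_apply_mul {p q d l : ι →₀ ℕ} (h : q + d = l) (hpq : p ≤ q) (hpl : p ≤ l)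
    (hd : d ≠ 0) (S : compacts A (X p)) (x : X q) (y : X d) :
    P.iota hpl S (P.mul h x y) = P.mul h (P.iota hpq S x) y := by
  by_cases h0 : p = 0
  · subst h0
    obtain ⟨a, ha⟩ := P.exists_lact_eq S
    rw [P.iota_zero _ S ha, P.iota_zero _ S ha, P.lact_mul]
  by_cases he : p = q
  · subst he
    rw [iota_self, P.iota_mul_of_add_eq h hpl h0 hd]
  obtain ⟨c, rfl⟩ := le_iff_exists_add.1 hpq
  have hc : c ≠ 0 := by
    rintro rfl
    exact he (add_zero p).symm
  have hcd : c + d ≠ 0 := fun h => hc (add_eq_zero.1 h).1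
  have hl : p + (c + d) = l := by rw [← h, add_assoc]
  refine (P.denseRange_tensorMul (m := p) (n := c) rfl h0 hc).induction_on (p := fun x =>
    P.iota hpl S (P.mul h x y) = P.mul h (P.iota hpq S x) y) x (isClosed_eq
      ((P.iota hpl S).comp (P.mulRight h hd y)).continuous
      ((P.mulRight h hd y).comp (P.iota hpq S)).continuous) fun t => ?_
  induction t with
  | zero => simp
  | add s t hs ht => simp only [map_add, LinearMap.add_apply, hs, ht]
  | tmul u v =>
    rw [tensorMul, TensorProduct.lift.tmul, P.mul_assoc rfl h rfl hl,
      P.iota_mul_of_add_eq hl hpl h0 hcd, P.iota_mul_of_add_eq rfl hpq h0 hc,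
      P.mul_assoc rfl h rfl hl]

/-- For `s < l` the products from `X_s X_{l-s}` are total in `X_l`, and the left action only touches
the first factor. -/
theorem lact_eq_zero_of_le (P : ProductSystem A X) {s l : ι →₀ ℕ} (hs : s ≠ 0) (h : s ≤ l) {a : A}
    (ha : lact (X s) a = 0) : lact (X l) a = 0 := by
  by_cases he : s = l
  · rwa [← he]
  · refine P.ext_of_mul (add_tsub_cancel_of_le h) hs (tsub_ne_zero_of h he) fun x y => ?_
    rw [P.lact_mul, ha]
    simp


/-! ### The ideals `I_r` and the submodules `X_q I_r` -/

/-- A degree `s ≤ r + e` either has `s_i = 0`, and then `s ≤ r`, or dominates the generator `e`, so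
that an element acting as zero on `X_e` also does so on `X_s`. -/
theorem mem_kerIdeal_add_single (P : ProductSystem A X) {r : ι →₀ ℕ} {i : ι} {a : A}
    (ha : a ∈ kerIdeal A X r) (hi : lact (X (Finsupp.single i 1)) a = 0) :
    a ∈ kerIdeal A X (r + Finsupp.single i 1) := by
  classical
  intro s h0 hs
  by_cases hsi : s i = 0
  · refine ha s h0 fun j => ?_
    have hj := hs j
    by_cases hij : i = j
    · subst hij
      simp [hsi]
    · simpa [Finsupp.single_apply, hij] using hj
  · refine P.lact_eq_zero_of_le (by simp) ?_ hi
    rw [Finsupp.single_le_iff]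
    omega

/-- The commutativity of the semigroup enters here: `a` kills `X_s`, hence `X_{s+e} = X_{e+s}`. So
`(ay)z = 0` for `z ∈ X_s`, which forces `⟨ay, ay⟩` to act as zero on `X_s`. -/
theorem lact_apply_mem_fibreIdeal (P : ProductSystem A X) {r e : ι →₀ ℕ} {a : A}
    (ha : a ∈ kerIdeal A X r) (y : X e) : lact (X e) a y ∈ fibreIdeal A X e r := by
  intro s h0 hs
  ext z
  refine rinner_ext A fun w => ?_
  have hz : lact (X (e + s)) a = 0 :=
    P.lact_eq_zero_of_le h0.ne' le_add_self (ha s h0 hs)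
  rw [← P.rinner_mul_mul rfl h0.ne', ← P.lact_mul, ← P.lact_mul, hz]
  simp [rinner_zero_right]

/-- `⟨xy, xy⟩ = ⟨y, ⟨x, x⟩y⟩` is an inner product with one entry in `X_e I_r`, hence lies in `I_r`
by Cauchy–Schwarz. -/
theorem mul_mem_fibreIdeal {q e l r : ι →₀ ℕ} (h : q + e = l) (he : e ≠ 0) (x : X q) {y : X e}
    (hy : y ∈ fibreIdeal A X e r) : P.mul h x y ∈ fibreIdeal A X l r := by
  intro s h0 hs
  rw [P.rinner_mul_mul h he, ← star_rinner]
  exact lact_star_eq_zero (lact_rinner_eq_zero _ (hy s h0 hs))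

/-- An element of the ideal `I_r` which annihilates `X_e I_r` annihilates `X_e`. -/
theorem lact_eq_zero_of_fibreIdeal (P : ProductSystem A X) {r e : ι →₀ ℕ} {a : A}
    (ha : a ∈ kerIdeal A X r) (hsa : star a = a)
    (h : ∀ y ∈ fibreIdeal A X e r, lact (X e) a y = 0) : lact (X e) a = 0 := by
  ext y
  refine eq_zero_of_rinner_self (A := A) ?_
  -- `⟨ay, ay⟩ = ⟨y, a(ay)⟩`, and `ay` belongs to `X_e I_r`.
  rw [rinner_lact, hsa, h _ (P.lact_apply_mem_fibreIdeal ha y), rinner_zero_right]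

/-! ### Sums of the operators `ι_p^q(S_p)` on full fibres -/

/-- The operator `ι_p^q(S)` on `X_q`, which is `0` unless `p ≤ q`. -/
def iotaExt (p q : ι →₀ ℕ) (S : compacts A (X p)) : X q →L[ℂ] X q :=
  open scoped Classical in
  if h : p ≤ q then P.iota h S else 0

theorem component_iotaTilde_apply {p m : ι →₀ ℕ} (S : compacts A (X p)) (q : Set.Iic m)
    (ξ : fibreIdeal A X q.1 (m - q.1)) :
    (OpSum.component A X q (P.iotaTilde p m S) ξ : X q.1) = P.iotaExt p q.1 S ξ := by
  by_cases h : p ≤ q.1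
  · rw [P.component_iotaTilde_of_le S q h, iotaRestrict_apply, iotaExt, dif_pos h]
  · rw [P.component_iotaTilde_of_not_le S q h, iotaExt, dif_neg h]
    rfl

theorem iotaExt_mem_adjointables (p q : ι →₀ ℕ) (S : compacts A (X p)) :
    P.iotaExt p q S ∈ adjointables A (X q) := by
  rw [iotaExt]
  split_ifs with h
  · exact P.iota_mem_adjointables h S
  · exact zero_mem _

variable [DecidableEq ι]

/-- The operator `∑_{p ≤ n, p ≤ q} ι_p^q(S_p)` on `X_q`. -/
def iotaSum (n q : ι →₀ ℕ) (S : (p : ι →₀ ℕ) → compacts A (X p)) : X q →L[ℂ] X q :=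
  ∑ p ∈ Finset.Iic n, P.iotaExt p q (S p)

theorem iotaSum_mem_adjointables (n q : ι →₀ ℕ) (S : (p : ι →₀ ℕ) → compacts A (X p)) :
    P.iotaSum n q S ∈ adjointables A (X q) :=
  sum_mem fun p _ => P.iotaExt_mem_adjointables p q (S p)

/-- This trades restricted operators for operators on the full fibres, where the level `m` affects
only the submodules on which they must vanish. -/
theorem sum_iotaTilde_eq_zero_iff (n m : ι →₀ ℕ) (S : (p : ι →₀ ℕ) → compacts A (X p)) :
    ∑ p ∈ Finset.Iic n, P.iotaTilde p m (S p) = 0 ↔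
      ∀ q ≤ m, ∀ ξ ∈ fibreIdeal A X q (m - q), P.iotaSum n q S ξ = 0 := by
  have key : ∀ (q : Set.Iic m) (ξ : fibreIdeal A X q.1 (m - q.1)),
      (OpSum.component A X q (∑ p ∈ Finset.Iic n, P.iotaTilde p m (S p)) ξ : X q.1)
        = P.iotaSum n q.1 S ξ := fun q ξ => by
    rw [map_sum, iotaSum, sum_apply, sum_apply, Submodule.coe_sum]
    exact Finset.sum_congr rfl fun p _ => P.component_iotaTilde_apply (S p) q ξ
  constructor
  · intro h q hq ξ hξ
    rw [← key ⟨q, hq⟩ ⟨ξ, hξ⟩, h]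
    rfl
  · refine fun h => OpSum.ext_component fun q => ?_
    ext ξ
    rw [key, h q.1 q.2 ξ ξ.2]
    rfl

/-- If `q` and `q + e` dominate the same `p ≤ n`, then the operator on `X_{q + e}` is obtained
from the one on `X_q` by acting on the first factor. -/
theorem iotaSum_mul {n q e l : ι →₀ ℕ} (h : q + e = l) (he : e ≠ 0)
    (hn : ∀ p ≤ n, p ≤ l → p ≤ q) (S : (p : ι →₀ ℕ) → compacts A (X p)) (x : X q) (y : X e) :
    P.iotaSum n l S (P.mul h x y) = P.mul h (P.iotaSum n q S x) y := by
  rw [iotaSum, iotaSum, sum_apply, sum_apply, map_sum, LinearMap.sum_apply]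
  refine Finset.sum_congr rfl fun p hp => ?_
  have hql : q ≤ l := h ▸ le_self_add
  by_cases hpq : p ≤ q
  · rw [iotaExt, iotaExt, dif_pos hpq, dif_pos (hpq.trans hql)]
    exact P.iota_apply_mul h hpq _ he _ x y
  · rw [iotaExt, iotaExt, dif_neg hpq, dif_neg fun hpl => hpq (hn p (Finset.mem_Iic.1 hp) hpl)]
    simp

/-! ### Descent along one generator -/

theorem sum_iotaTilde_eq_zero_of_add_single (n : ι →₀ ℕ) (i : ι)
    (S : (p : ι →₀ ℕ) → compacts A (X p))
    (h : ∑ p ∈ Finset.Iic n, P.iotaTilde p (n + Finsupp.single i 1) (S p) = 0) :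
    ∑ p ∈ Finset.Iic n, P.iotaTilde p n (S p) = 0 := by
  set e : ι →₀ ℕ := Finsupp.single i 1 with he_def
  have he : e ≠ 0 := by simp [he_def]
  rw [sum_iotaTilde_eq_zero_iff] at h ⊢
  intro q hq ξ hξ
  have hsub : n + e - q = n - q + e := tsub_add_eq_add_tsub hq |>.symm
  set T := P.iotaSum n q S with hT
  obtain ⟨T', hT'⟩ := P.iotaSum_mem_adjointables n q S
  have hTξ : T ξ ∈ fibreIdeal A X q (n - q) :=
    mapsTo_fibreIdeal _ (P.iotaSum_mem_adjointables n q S) hξ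
  -- The one condition missing for `⟨Tξ, Tξ⟩` to lie in `I_{n-q+e}`.
  have hc : lact (X e) (rinner A (T ξ) (T ξ)) = 0 := by
    by_cases her : e ≤ n - q
    · exact hTξ e (pos_iff_ne_zero.2 he) her
    · have hi : n i ≤ q i := by
        rw [he_def, Finsupp.single_le_iff, Finsupp.tsub_apply] at her
        omega
      refine P.lact_eq_zero_of_fibreIdeal hTξ (star_rinner A _ _) fun y hy => ?_
      refine rinner_ext A fun z => ?_
      have hmul : P.mul rfl (T ξ) y = 0 := by
        rw [hT, ← P.iotaSum_mul rfl he _ S]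
        · refine h (q + e) (add_le_add_left hq e) _ ?_
          -- The ideal at `q + e` for level `n + e` is again `I_{n-q}`.
          rw [add_tsub_add_eq_tsub_right]
          exact P.mul_mem_fibreIdeal rfl he ξ hy
        · intro p hpn hpl j
          by_cases hij : i = j
          · subst hij
            exact (hpn i).trans hi
          · simpa [he_def, Finsupp.single_apply, hij] using hpl j
      rw [← P.rinner_mul_mul rfl he, hmul]
      simp only [rinner_zero_right]
  have hmem : T ξ ∈ fibreIdeal A X q (n + e - q) := by
    rw [hsub]
    exact P.mem_kerIdeal_add_single hTξ hc
  have hadj : T' ∈ adjointables A (X q) :=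
    ⟨T, fun x y => by rw [← star_rinner, ← hT', star_rinner]⟩
  -- The hypothesis is applied to `T*Tξ`, since `ξ` itself need not lie in `X_q I_{n+e-q}`.
  have hzero := h q (hq.trans le_self_add) _ (mapsTo_fibreIdeal _ hadj hmem)
  have hT'0 : T' (T ξ) = 0 := eq_zero_of_rinner_self (A := A) (by
    rw [← hT', hzero, rinner_zero_left])
  exact eq_zero_of_rinner_self (A := A) (by rw [hT', hT'0, rinner_zero_right])

/-! ### Descent between arbitrary levels, and injectivity -/

theorem sum_iotaTilde_eq_zero_of_add (d : ι →₀ ℕ) : ∀ (n : ι →₀ ℕ)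
    (S : (p : ι →₀ ℕ) → compacts A (X p)),
    ∑ p ∈ Finset.Iic n, P.iotaTilde p (n + d) (S p) = 0 →
      ∑ p ∈ Finset.Iic n, P.iotaTilde p n (S p) = 0 := by
  have hadd : ∀ d₁ d₂ : ι →₀ ℕ,
      (∀ (n : ι →₀ ℕ) (S : (p : ι →₀ ℕ) → compacts A (X p)),
        ∑ p ∈ Finset.Iic n, P.iotaTilde p (n + d₁) (S p) = 0 →
        ∑ p ∈ Finset.Iic n, P.iotaTilde p n (S p) = 0) →
      (∀ (n : ι →₀ ℕ) (S : (p : ι →₀ ℕ) → compacts A (X p)),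
        ∑ p ∈ Finset.Iic n, P.iotaTilde p (n + d₂) (S p) = 0 →
        ∑ p ∈ Finset.Iic n, P.iotaTilde p n (S p) = 0) →
      ∀ (n : ι →₀ ℕ) (S : (p : ι →₀ ℕ) → compacts A (X p)),
        ∑ p ∈ Finset.Iic n, P.iotaTilde p (n + (d₁ + d₂)) (S p) = 0 →
        ∑ p ∈ Finset.Iic n, P.iotaTilde p n (S p) = 0 := by
    intro d₁ d₂ h₁ h₂ n S h
    -- Padding with zeros turns the sum over `p ≤ n` into one over `p ≤ n + d₁`, so that the step by
    -- `d₂` applies at base `n + d₁`.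
    obtain ⟨T, hT⟩ := P.exists_extend_family (le_self_add : n ≤ n + d₁) S
    refine h₁ n S ?_
    rw [← hT]
    refine h₂ _ T ?_
    rwa [hT, add_assoc]
  induction d using Finsupp.induction_linear with
  | zero =>
    intro n S h
    rwa [add_zero] at h
  | add d₁ d₂ h₁ h₂ => exact hadd d₁ d₂ h₁ h₂
  | single i k =>
    induction k with
    | zero =>
      intro n S h
      rwa [Finsupp.single_zero, add_zero] at h
    | succ k ih =>
      rw [Finsupp.single_add]
      exact hadd _ _ ih fun n S => P.sum_iotaTilde_eq_zero_of_add_single n i S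

theorem sum_iotaTilde_eq_zero_of_le {n m : ι →₀ ℕ} (h : n ≤ m)
    (S : (p : ι →₀ ℕ) → compacts A (X p))
    (hS : ∑ p ∈ Finset.Iic n, P.iotaTilde p m (S p) = 0) :
    ∑ p ∈ Finset.Iic n, P.iotaTilde p n (S p) = 0 := by
  obtain ⟨d, rfl⟩ := le_iff_exists_add.1 h
  exact P.sum_iotaTilde_eq_zero_of_add d n S hS

/-- A component at `q ≥ n` with `q ≱ m` is not seen by `jTilde`, but the one at `q ∨ m` is. The
family, padded by zeros to all `p ≤ q`, descends from `q ∨ m` to `q`. -/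
theorem jTilde_injective {n m : ι →₀ ℕ} (h : n ≤ m) : Function.Injective (P.jTilde h) := by
  refine (injective_iff_map_eq_zero _).2 fun f hf => Subtype.ext (funext fun q => Subtype.ext ?_)
  obtain ⟨S, hS⟩ := f.2
  obtain ⟨T, hT⟩ := P.exists_extend_family q.2 S
  have hq : n ≤ q.1 ⊔ m := h.trans le_sup_right
  have hf' : f.1 ⟨q.1 ⊔ m, hq⟩ = 0 := by
    rw [← P.coe_jTilde_apply h f ⟨q.1 ⊔ m, (le_sup_right : m ≤ q.1 ⊔ m)⟩, hf]
    rfl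
  rw [hS q, ← hT]
  refine P.sum_iotaTilde_eq_zero_of_le (le_sup_left : q.1 ≤ q.1 ⊔ m) T ?_
  rw [hT, ← hS ⟨q.1 ⊔ m, hq⟩, hf']
  rfl

end ProductSystem

end CNP

end

theorem mainTheorem7 {A : Type*} [NonUnitalCStarAlgebra A] [PartialOrder A] [StarOrderedRing A]
    {ι : Type*} [DecidableEq ι]
    {X : (ι →₀ ℕ) → Type*} [∀ n, NormedAddCommGroup (X n)] [∀ n, NormedSpace ℂ (X n)]
    [∀ n, CompleteSpace (X n)] [∀ n, SMul Aᵐᵒᵖ (X n)] [∀ n, CStarModule Aᵐᵒᵖ (X n)]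
    [∀ n, CNP.HilbertBimodule A (X n)]
    (P : CNP.ProductSystem A X) (hP : P.CompactlyAligned) :
    (∀ (n m : ι →₀ ℕ), n ≤ m → ∀ S : (p : ι →₀ ℕ) → CNP.compacts A (X p),
      ∑ p ∈ Finset.Iic n, P.iotaTilde p m (S p) = 0 →
        ∑ p ∈ Finset.Iic n, P.iotaTilde p n (S p) = 0) ∧
    (∀ (n m : ι →₀ ℕ) (h : n ≤ m), Function.Injective (P.jTilde h)) := by
  exact ⟨fun n m h S hS => P.sum_iotaTilde_eq_zero_of_le h S hS, fun n m h => P.jTilde_injective h⟩
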